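/- **Conventions.** Hilbert spaces are complex. A representation of a unital $C^*$-algebra $\mathscr A$ is a unital $*$-homomorphism $\pi\colon\mathscr A\to B(\mathcal H)$. A character is a nonzero multiplicative linear functional. A closed subspace reduces an operator $T$ if it is invariant under $T$ and $T^*$; it reduces $\pi$ if it reduces every $\pi(a)$. The symbol $\bigvee$ denotes closed linear span, and $\triangle_R=I-R^*R$. A set $G\subseteq\mathscr A$ is *hyperrigid* if it is finite or countably infinite, generates $\mathscr A$ as a unital $C^*$-algebra, and for every faithful representation $\pi\colon\mathscr A\to B(\mathcal H)$ on a separable Hilbert space and every sequence $(\Phi_k)$ of unital completely positive maps $B(\mathcal H)\to B(\mathcal H)$, if $\|\Phi_k(\pi(g))-\pi(g)\|\to0$ for all $g\in G$, then $\|\Phi_k(\pi(a))-\pi(a)\|\to0$ for all $a\in\mathscr A$. For a character $\chi$ put $$\mathcal M_\chi(\pi)=\bigcap_{a\in\mathscr A}\ker(\pi(a)-\chi(a)I).$$ Let $\pi,\rho$ be representations of $\mathscr A$ on $\mathcal H,\mathcal K$ and $R\in B(\mathcal H,\mathcal K)$ a contraction. For closed subspaces $\mathcal H_0,\mathcal H_1\subseteq\mathcal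 H$ and $\mathcal K_0,\mathcal K_1\subseteq\mathcal K$, the triple $(\pi,\rho,R)$ has an *isometric* (resp. *unitary*) *$\chi$-decomposition* relative to $(\mathcal H_0,\mathcal H_1,\mathcal K_0,\mathcal K_1)$ if 1. $\mathcal H=\mathcal H_0\oplus\mathcal H_1$ and $\mathcal K=\mathcal K_0\oplus\mathcal K_1$ (orthogonal sums); 2. $\mathcal H_0,\mathcal H_1$ reduce $\pi$ and $\mathcal K_0,\mathcal K_1$ reduce $\rho$; 3. $\pi(a)|_{\mathcal H_1}=\chi(a)I_{\mathcal H_1}$ and $\rho(a)|_{\mathcal K_1}=\chi(a)I_{\mathcal K_1}$ for all $a\in\mathscr A$; 4. $R=R_0\oplus R_1$ with $R_0\in B(\mathcal H_0,\mathcal K_0)$ isometric (resp. unitary) and $R_1\in B(\mathcal H_1,\mathcal K_1)$; 5. $\pi(a)|_{\mathcal H_0}=R_0^*\,\rho(a)|_{\mathcal K_0}R_0$ for all $a\in\mathscr A$. **Theorem.** Let $G$ be a hyperrigid subset of a unital $C^*$-algebra $\mathscr A$ and let $\chi$ be a character of $\mathscr A$ with $G\subseteq\ker\chi$. Let $\pi\colon\mathscr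 A\to B(\mathcal H)$ and $\rho\colon\mathscr A\to B(\mathcal K)$ be representations on separable Hilbert spaces, and let $R\in B(\mathcal H,\mathcal K)$ be a contraction such that $\pi(g)=R^*\rho(g)R$ for every $g\in G$. Put $$\mathcal L_\chi=\bigvee_{a\in\mathscr A}\rho(a)R(\mathcal M_\chi(\pi)),\qquad \mathcal L_{\chi_\perp}=\bigvee_{a\in\mathscr A}\rho(a)R(\mathcal M_\chi(\pi)^\perp).$$ Then: * (i) $\mathcal M_\chi(\pi)$ reduces $\pi$, $R^*R$ and $\triangle_R$. * (ii) $\mathcal L_\chi$ and $\mathcal L_{\chi_\perp}$ reduce $\rho$. * (iii) $\mathcal L_\chi=\overline{R(\mathcal M_\chi(\pi))}$, $\mathcal L_{\chi_\perp}=\overline{R(\mathcal M_\chi(\pi)^\perp)}$ and $\mathcal L_\chi\perp\mathcal L_{\chi_\perp}$. * (iv) $R(\mathcal M_\chi(\pi))\subseteq\mathcal M_\chi(\rho)$ and $\operatorname{ran}(\triangle_R)\subseteq\mathcal M_\chi(\pi)$. * (v) $(\pi,\rho,R)$ has an isometric $\chi$-decomposition relative to $(\mathcal H_0,\mathcal H_1,\mathcal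 K_0,\mathcal K_1)$, where $\mathcal H_0=\mathcal M_\chi(\pi)^\perp$, $\mathcal H_1=\mathcal M_\chi(\pi)$, $\mathcal K_0=\mathcal L_\chi^\perp$, $\mathcal K_1=\mathcal L_\chi$. * (vi) For the block $R_0$ of $R$ in (v), $R_0\,\pi(a)|_{\mathcal H_0}=\rho(a)|_{\mathcal K_0}R_0$ for all $a\in\mathscr A$. Moreover, if $\mathcal K=\bigvee_{a\in\mathscr A}\rho(a)R(\mathcal H)$, then $\mathcal L_{\chi_\perp}=\mathcal L_\chi^\perp$ and $R_0$ is unitary, so $(\pi,\rho,R)$ has a unitary $\chi$-decomposition relative to $(\mathcal H_0,\mathcal H_1,\mathcal K_0,\mathcal K_1)$. -/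

import Mathlib

open scoped CStarAlgebra InnerProductSpace

universe t u v w

namespace ChiDecomp

noncomputable section

section Hyperrigid

variable {A : Type u} [CStarAlgebra A]

/-- A finite or countably infinite set `G` of generators of the unital C⋆-algebra `A` is
hyperrigid if, for every faithful (unital) representation `π` of `A` on a separable Hilbert
space `H` and every sequence of unital completely positive maps `Φ k : B(H) → B(H)`, convergence
`‖Φ k (π g) - π g‖ → 0` for all `g ∈ G` forces `‖Φ k (π a) - π a‖ → 0` for all `a ∈ A`.
Here `H` ranges over the separable complex Hilbert spaces in `Type t`. The choice of `t` is
immaterial: every separable Hilbert space has unitary copies in every universe. -/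
structure IsHyperrigid (G : Set A) : Prop where
  countable : G.Countable
  generates : (StarAlgebra.adjoin ℂ G).topologicalClosure = ⊤
  rigid : ∀ (H : Type t) [NormedAddCommGroup H] [InnerProductSpace ℂ H] [CompleteSpace H]
    [TopologicalSpace.SeparableSpace H] (π : A →⋆ₐ[ℂ] (H →L[ℂ] H)),
    Function.Injective π →
    ∀ Φ : ℕ → ((H →L[ℂ] H) →CP (H →L[ℂ] H)), (∀ k, Φ k 1 = 1) →
    (∀ g ∈ G, Filter.Tendsto (fun k => ‖Φ k (π g) - π g‖) Filter.atTop (nhds 0)) →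
    ∀ a : A, Filter.Tendsto (fun k => ‖Φ k (π a) - π a‖) Filter.atTop (nhds 0)

end Hyperrigid

section Reducing

variable {A : Type u} [CStarAlgebra A]
variable {H : Type v} [NormedAddCommGroup H] [InnerProductSpace ℂ H] [CompleteSpace H]

/-- The subspace `M` reduces the operator `T`: it is invariant under `T` and `T*`. -/
def Reduces (M : Submodule ℂ H) (T : H →L[ℂ] H) : Prop :=
  (∀ x ∈ M, T x ∈ M) ∧ ∀ x ∈ M, ContinuousLinearMap.adjoint T x ∈ M

/-- The subspace `M` reduces the representation `π`: it reduces every `π a`. -/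
def ReducesRep (M : Submodule ℂ H) (π : A →⋆ₐ[ℂ] (H →L[ℂ] H)) : Prop :=
  ∀ a, Reduces M (π a)

/-- The restriction `π(a)|_M`, as an operator on `M`, for `M` reducing `π`. -/
def restrictRep (π : A →⋆ₐ[ℂ] (H →L[ℂ] H)) {M : Submodule ℂ H} (hM : ReducesRep M π) (a : A) :
    M →L[ℂ] M :=
  (π a).restrict (hM a).1

/-- The generalized joint eigenspace `⋂ a, ker (π a - χ a • I)`. -/
def jointEigenspace (χ : WeakDual.characterSpace ℂ A) (π : A →⋆ₐ[ℂ] (H →L[ℂ] H)) :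
    Submodule ℂ H :=
  ⨅ a : A, LinearMap.ker ((π a - χ a • (1 : H →L[ℂ] H) : H →L[ℂ] H) : H →ₗ[ℂ] H)

theorem isClosed_jointEigenspace (χ : WeakDual.characterSpace ℂ A)
    (π : A →⋆ₐ[ℂ] (H →L[ℂ] H)) : IsClosed (jointEigenspace χ π : Set H) := by
  unfold jointEigenspace
  rw [Submodule.coe_iInf]
  exact isClosed_iInter fun a => (π a - χ a • (1 : H →L[ℂ] H)).isClosed_ker

instance completeSpace_jointEigenspace (χ : WeakDual.characterSpace ℂ A)
    (π : A →⋆ₐ[ℂ] (H →L[ℂ] H)) : CompleteSpace (jointEigenspace χ π) :=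
  (isClosed_jointEigenspace χ π).completeSpace_coe

end Reducing

section Decomposition

variable {A : Type u} [CStarAlgebra A]
variable {H : Type v} [NormedAddCommGroup H] [InnerProductSpace ℂ H] [CompleteSpace H]
variable {K : Type w} [NormedAddCommGroup K] [InnerProductSpace ℂ K] [CompleteSpace K]

/-- The operator `△_R = I - R*R`. -/
def defect (R : H →L[ℂ] K) : H →L[ℂ] H :=
  1 - ContinuousLinearMap.adjoint R ∘L R

/-- `⋁ a, ρ(a) R(M)`: the closed linear span of the subspaces `ρ(a) R(M)`, `a ∈ A`. -/
def closedSpan (ρ : A →⋆ₐ[ℂ] (K →L[ℂ] K)) (R : H →L[ℂ] K) (M : Submodule ℂ H) :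
    Submodule ℂ K :=
  (⨆ a : A, M.map ((ρ a ∘L R : H →L[ℂ] K) : H →ₗ[ℂ] K)).topologicalClosure

instance completeSpace_closedSpan (ρ : A →⋆ₐ[ℂ] (K →L[ℂ] K)) (R : H →L[ℂ] K)
    (M : Submodule ℂ H) : CompleteSpace (closedSpan ρ R M) :=
  (Submodule.isClosed_topologicalClosure _).completeSpace_coe

/-- The conditions common to isometric and unitary `χ`-decompositions of `(π, ρ, R)` relative to
the closed subspaces `(H₀, H₁, K₀, K₁)`, with diagonal blocks `R₀` and `R₁` of `R`.
Closedness of the subspaces is expressed by their completeness. -/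
structure IsChiDecomposition (χ : WeakDual.characterSpace ℂ A)
    (π : A →⋆ₐ[ℂ] (H →L[ℂ] H)) (ρ : A →⋆ₐ[ℂ] (K →L[ℂ] K)) (R : H →L[ℂ] K)
    (H₀ H₁ : Submodule ℂ H) (K₀ K₁ : Submodule ℂ K)
    [CompleteSpace H₀] [CompleteSpace H₁] [CompleteSpace K₀] [CompleteSpace K₁]
    (R₀ : H₀ →L[ℂ] K₀) (R₁ : H₁ →L[ℂ] K₁) : Prop where
  orthoH : H₀ ⟂ H₁
  sumH : H₀ ⊔ H₁ = ⊤
  orthoK : K₀ ⟂ K₁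
  sumK : K₀ ⊔ K₁ = ⊤
  reducesH₀ : ReducesRep H₀ π
  reducesH₁ : ReducesRep H₁ π
  reducesK₀ : ReducesRep K₀ ρ
  reducesK₁ : ReducesRep K₁ ρ
  scalarH₁ : ∀ a, restrictRep π reducesH₁ a = χ a • (1 : H₁ →L[ℂ] H₁)
  scalarK₁ : ∀ a, restrictRep ρ reducesK₁ a = χ a • (1 : K₁ →L[ℂ] K₁)
  block₀ : ∀ x : H₀, R x = R₀ x
  block₁ : ∀ x : H₁, R x = R₁ x
  compress : ∀ a, restrictRep π reducesH₀ a =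
    ContinuousLinearMap.adjoint R₀ ∘L restrictRep ρ reducesK₀ a ∘L R₀

/-- An isometric `χ`-decomposition: a `χ`-decomposition whose block `R₀` is isometric. -/
structure IsIsometricChiDecomposition (χ : WeakDual.characterSpace ℂ A)
    (π : A →⋆ₐ[ℂ] (H →L[ℂ] H)) (ρ : A →⋆ₐ[ℂ] (K →L[ℂ] K)) (R : H →L[ℂ] K)
    (H₀ H₁ : Submodule ℂ H) (K₀ K₁ : Submodule ℂ K)
    [CompleteSpace H₀] [CompleteSpace H₁] [CompleteSpace K₀] [CompleteSpace K₁]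
    (R₀ : H₀ →L[ℂ] K₀) (R₁ : H₁ →L[ℂ] K₁) : Prop
    extends IsChiDecomposition χ π ρ R H₀ H₁ K₀ K₁ R₀ R₁ where
  isometric : Isometry R₀

/-- A unitary `χ`-decomposition: a `χ`-decomposition whose block `R₀` is unitary. -/
structure IsUnitaryChiDecomposition (χ : WeakDual.characterSpace ℂ A)
    (π : A →⋆ₐ[ℂ] (H →L[ℂ] H)) (ρ : A →⋆ₐ[ℂ] (K →L[ℂ] K)) (R : H →L[ℂ] K)
    (H₀ H₁ : Submodule ℂ H) (K₀ K₁ : Submodule ℂ K)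
    [CompleteSpace H₀] [CompleteSpace H₁] [CompleteSpace K₀] [CompleteSpace K₁]
    (R₀ : H₀ →L[ℂ] K₀) (R₁ : H₁ →L[ℂ] K₁) : Prop
    extends IsChiDecomposition χ π ρ R H₀ H₁ K₀ K₁ R₀ R₁ where
  adjoint_comp_self : ContinuousLinearMap.adjoint R₀ ∘L R₀ = 1
  self_comp_adjoint : R₀ ∘L ContinuousLinearMap.adjoint R₀ = 1

end Decomposition

end

end ChiDecomp

/-! Hyperrigidity forces a compression formula valid on `G` to hold on all of `A`. If `V` is an
isometry with `π g = V* τ(g) V` on `G`, then the completely positive map replacing the `π` corner of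
`σ ⊕ π ⊕ τ` by `V* τ V`, with `σ` faithful, is unital and fixes `G`; the constant sequence then
gives `π = V* τ V` everywhere (`IsHyperrigid.eq_compression`), and multiplicativity makes `V` an
intertwiner (`intertwines_of_eq_compression`).

The contraction `R` becomes such an isometry as the column `V = (R, D)` with `D*D = I - R*R`, where
`τ = ρ ⊕ χ`: since `χ` vanishes on `G`, the added summand is invisible on generators. The components
of `τ V = V π` read `ρ(a) R = R π(a)` and `χ(a) D = D π(a)`; the adjoint of the second puts the
range of the defect in the joint eigenspace (`intertwines_and_range_defect_le`). The remaining
claims are Hilbert space geometry based on these two facts. -/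

namespace ChiDecomp

/-! ### Separability of the algebra. -/

section Separable

theorem _root_.Submonoid.countable_closure {M : Type*} [Monoid M] {s : Set M}
    (hs : s.Countable) : (Submonoid.closure s : Set M).Countable := by
  have := hs.to_subtype
  rw [Submonoid.closure_eq_mrange, MonoidHom.coe_mrange]
  have : Countable (FreeMonoid s) := inferInstanceAs (Countable (List s))
  exact Set.countable_range _

open TopologicalSpace in
-- The generated star subalgebra is the linear span of the countable monoid generated by `G ∪ star
-- G`.
theorem separableSpace_of_generates {A : Type u} [CStarAlgebra A] {G : Set A} (hG : G.Countable)
    (hgen : (StarAlgebra.adjoin ℂ G).topologicalClosure = ⊤) : SeparableSpace A := by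
  have hsep : IsSeparable ((StarAlgebra.adjoin ℂ G : StarSubalgebra ℂ A) : Set A) := by
    have hcoe : ((StarAlgebra.adjoin ℂ G : StarSubalgebra ℂ A) : Set A) =
        (Submodule.span ℂ (Submonoid.closure (G ∪ star G) : Set A) : Set A) := by
      rw [← Algebra.adjoin_eq_span]
      rfl
    rw [hcoe]
    refine (Set.Countable.isSeparable ?_).span
    refine Submonoid.countable_closure (hG.union ?_)
    rw [← Set.image_star]
    exact hG.image _
  have huniv : IsSeparable (Set.univ : Set A) := by
    have := hsep.closure
    rwa [← StarSubalgebra.topologicalClosure_coe, hgen, StarSubalgebra.coe_top] at this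
  exact isSeparable_univ_iff.mp huniv

end Separable

/-! ### Faithful positive functionals on separable C⋆-algebras. -/

section FaithfulFunctional

variable {A : Type u} [CStarAlgebra A] [PartialOrder A] [StarOrderedRing A]

/-- The closed convex cone of nonnegative elements of a C⋆-algebra. -/
def nonnegCone (A : Type u) [CStarAlgebra A] [PartialOrder A] [StarOrderedRing A] :
    ProperCone ℝ A where
  carrier := {a | 0 ≤ a}
  add_mem' ha hb := add_nonneg ha hb
  zero_mem' := le_refl (0 : A)
  smul_mem' c _ ha := smul_nonneg c.2 ha
  isClosed' := CStarAlgebra.isClosed_nonneg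

/-- The cone of nonnegative elements is closed and pointed, so a hyperplane separates `-b` from it.
-/
theorem exists_nonneg_dual_pos {b : A} (hb : 0 ≤ b) (hb0 : b ≠ 0) :
    ∃ f : A →L[ℝ] ℝ, (∀ a, 0 ≤ a → 0 ≤ f a) ∧ 0 < f b := by
  have hmem : -b ∉ nonnegCone A := fun h =>
    hb0 (le_antisymm (neg_nonneg.mp (show (0 : A) ≤ -b from h)) hb)
  obtain ⟨f, hf, hfb⟩ := (nonnegCone A).hyperplane_separation_point hmem
  exact ⟨f, fun a ha => hf a ha, by simpa using hfb⟩

/-- The open sets `{F b > 0}` cover the nonzero nonnegative elements. By the Lindelöf property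
countably many suffice, and a weighted sum of the corresponding functionals is faithful. -/
theorem exists_faithful_real_functional [TopologicalSpace.SeparableSpace A] :
    ∃ f : A →L[ℝ] ℝ, ∀ a, 0 ≤ a → 0 ≤ f a ∧ (a ≠ 0 → 0 < f a) := by
  let ι := {b : A // 0 ≤ b ∧ b ≠ 0}
  choose F hF hFpos using fun b : ι => exists_nonneg_dual_pos b.2.1 b.2.2
  have := TopologicalSpace.isOpen_iUnion_countable (fun b : ι => {a | 0 < F b a})
    (fun b => isOpen_lt continuous_const (F b).continuous)
  obtain ⟨T, hT, hTU⟩ := this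
  have := hT.to_subtype
  have := Encodable.ofCountable T
  -- The second factor normalizes `F i`, and the geometric factor makes the series converge in norm.
  let c : T → ℝ := fun i => (1 / 2) ^ (Encodable.encode i) * (1 + ‖F i‖)⁻¹
  have hc : ∀ i, 0 < c i := fun i => by positivity
  have hsum : Summable fun i : T => c i • F i := by
    refine Summable.of_norm_bounded
      (g := fun i : T => (1 / 2 : ℝ) ^ (Encodable.encode i)) summable_geometric_two_encode
      fun i => ?_
    rw [norm_smul, Real.norm_of_nonneg (hc i).le, mul_assoc]
    refine mul_le_of_le_one_right (by positivity) ?_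
    rw [inv_mul_le_one₀ (by positivity)]
    linarith
  have happ : ∀ a, HasSum (fun i : T => c i * F i a) ((∑' i : T, c i • F i) a) := fun a => by
    simpa using (ContinuousLinearMap.apply ℝ ℝ a).hasSum hsum.hasSum
  have hnn : ∀ a, 0 ≤ a → ∀ i : T, 0 ≤ c i * F i a := fun a ha i =>
    mul_nonneg (hc i).le (hF i a ha)
  refine ⟨∑' i : T, c i • F i, fun a ha => ⟨(happ a).nonneg (hnn a ha), fun ha0 => ?_⟩⟩
  have hmem : a ∈ ⋃ i ∈ T, {a | 0 < F i a} := by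
    rw [hTU]
    exact Set.mem_iUnion.mpr ⟨⟨a, ha, ha0⟩, hFpos ⟨a, ha, ha0⟩⟩
  obtain ⟨i, hi, hia⟩ := Set.mem_iUnion₂.mp hmem
  exact (mul_pos (hc ⟨i, hi⟩) hia).trans_le
    (le_hasSum (happ a) ⟨i, hi⟩ fun j _ => hnn a ha j)

open scoped ComplexStarModule ComplexOrder in
theorem exists_faithful_positiveLinearMap [TopologicalSpace.SeparableSpace A] :
    ∃ f : A →ₚ[ℂ] ℂ, ∀ a, 0 ≤ a → f a = 0 → a = 0 := by
  obtain ⟨f, hf⟩ := exists_faithful_real_functional (A := A)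
  -- Precomposing with the real part ensures that the complex-linear extension still agrees with `f`
  -- on nonnegative elements.
  let g : A →ₗ[ℝ] ℝ := (f : A →ₗ[ℝ] ℝ) ∘ₗ (selfAdjoint.submodule ℝ A).subtype ∘ₗ realPart
  let h : A →ₗ[ℂ] ℂ := Module.Dual.extendRCLike g
  have hval : ∀ a, 0 ≤ a → h a = (f a : ℂ) := fun a ha => by
    have hsa : IsSelfAdjoint a := .of_nonneg ha
    have hg : ∀ x, g x = f (ℜ x : A) := fun x => rfl
    simp [h, Module.Dual.extendRCLike_apply, hg, hsa.coe_realPart, hsa.imaginaryPart]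
  refine ⟨.mk₀ h fun a ha => ?_, fun a ha h0 => ?_⟩
  · rw [hval a ha]
    exact_mod_cast (hf a ha).1
  · by_contra hne
    have := (hf a ha).2 hne
    have h0' : h a = 0 := h0
    rw [hval a ha] at h0'
    exact this.ne' (by exact_mod_cast h0')

end FaithfulFunctional

/-! ### A faithful representation on a separable space, by GNS. -/

section GNS

open scoped ComplexOrder

variable {A : Type u} [CStarAlgebra A] [PartialOrder A] [StarOrderedRing A]

/-- The squared seminorm of `a` is `f (star a * a)`, hence at most `C ‖a‖²`. Continuity carries
separability from `A` to the GNS space. -/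
theorem continuous_toPreGNS (f : A →ₚ[ℂ] ℂ) : Continuous f.toPreGNS := by
  obtain ⟨C, hC⟩ := f.exists_norm_apply_le
  refine (LinearMap.mkContinuousOfExistsBound (f.toPreGNS : A →ₗ[ℂ] f.PreGNS)
    ⟨√C, fun a => ?_⟩).continuous
  rw [← sq_le_sq₀ (by positivity) (by positivity), mul_pow, Real.sq_sqrt (x := (C : ℝ)) C.2]
  have h1 := congrArg (‖·‖) (f.preGNS_norm_sq (f.toPreGNS a))
  simp only [norm_pow, Complex.norm_real, norm_norm, f.ofPreGNS_toPreGNS] at h1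
  rw [LinearEquiv.coe_coe, h1, sq, ← CStarRing.norm_star_mul_self]
  exact hC _

/-- Applied to the vector of `1`, the image of `a` has squared norm `f (star a * a)`. -/
theorem gnsStarAlgHom_injective (f : A →ₚ[ℂ] ℂ) (hf : ∀ a, 0 ≤ a → f a = 0 → a = 0) :
    Function.Injective f.gnsStarAlgHom := by
  refine (injective_iff_map_eq_zero _).mpr fun a ha => ?_
  have h1 : f.gnsStarAlgHom a (f.toPreGNS 1 : f.GNS) = 0 := by rw [ha]; rfl
  have h2 : ‖f.leftMulMapPreGNS a (f.toPreGNS 1)‖ = 0 := by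
    rw [← UniformSpace.Completion.norm_coe, ← f.gnsNonUnitalStarAlgHom_apply_coe]
    rw [← norm_eq_zero] at h1
    exact h1
  have h3 := f.preGNS_norm_sq (f.leftMulMapPreGNS a (f.toPreGNS 1))
  rw [h2] at h3
  have h4 := hf (star a * a) (star_mul_self_nonneg a) (by simpa using h3.symm)
  exact CStarRing.star_mul_self_eq_zero_iff a |>.mp h4

end GNS

open scoped ComplexOrder in
theorem exists_faithful_representation (A : Type u) [CStarAlgebra A]
    [TopologicalSpace.SeparableSpace A] :
    ∃ (E : Type u) (_ : NormedAddCommGroup E) (_ : InnerProductSpace ℂ E) (_ : CompleteSpace E)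
      (_ : TopologicalSpace.SeparableSpace E) (σ : A →⋆ₐ[ℂ] (E →L[ℂ] E)),
      Function.Injective σ := by
  let := CStarAlgebra.spectralOrder A
  have : StarOrderedRing A := CStarAlgebra.spectralOrderedRing A
  obtain ⟨f, hf⟩ := exists_faithful_positiveLinearMap (A := A)
  have : TopologicalSpace.SeparableSpace f.PreGNS :=
    (f.toPreGNS.surjective.denseRange).separableSpace (continuous_toPreGNS f)
  exact ⟨f.GNS, inferInstance, inferInstance, inferInstance, inferInstance, f.gnsStarAlgHom,
    gnsStarAlgHom_injective f hf⟩

/-! ### Completely positive maps with two Kraus operators. -/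

section CompletelyPositive

variable {B : Type*} [CStarAlgebra B] [PartialOrder B] [StarOrderedRing B]

/-- The completely positive map `T ↦ C* T C + D* T D`. -/
def conjAddCP (C D : B) : B →CP B where
  toFun T := star C * T * C + star D * T * D
  map_add' S T := by noncomm_ring
  map_smul' c T := by simp
  map_cstarMatrix_nonneg' k M hM := by
    -- Matrix amplification turns conjugation by `C` into conjugation by the constant diagonal
    -- matrix, which preserves positivity.
    let diag : B → CStarMatrix (Fin k) (Fin k) B :=
      fun C => CStarMatrix.ofMatrix (Matrix.diagonal fun _ => C)
    have key : ∀ (C : B) (i j : Fin k), (star (diag C) * M * diag C) i j = star C * M i j * C := by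
      intro C i j
      simp [diag, CStarMatrix.mul_apply, CStarMatrix.star_apply, Matrix.diagonal_apply,
        apply_ite star]
    have : M.map (fun T => star C * T * C + star D * T * D) =
        star (diag C) * M * diag C + star (diag D) * M * diag D := by
      ext i j
      rw [CStarMatrix.add_apply, key, key, CStarMatrix.map_apply]
    change 0 ≤ M.map (fun T => star C * T * C + star D * T * D)
    rw [this]
    exact add_nonneg (star_left_conjugate_nonneg hM _) (star_left_conjugate_nonneg hM _)

theorem conjAddCP_apply (C D T : B) : conjAddCP C D T = star C * T * C + star D * T * D := rfl

end CompletelyPositive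

/-! ### Operators and representations on orthogonal direct sums. -/

section DirectSum

open ContinuousLinearMap

variable {E F X : Type*} [NormedAddCommGroup E] [InnerProductSpace ℂ E]
  [NormedAddCommGroup F] [InnerProductSpace ℂ F]
  [NormedAddCommGroup X] [InnerProductSpace ℂ X]

/-- The column operator `x ↦ (S x, T x)` into the orthogonal direct sum. -/
noncomputable def column (S : X →L[ℂ] E) (T : X →L[ℂ] F) : X →L[ℂ] WithLp 2 (E × F) :=
  ((WithLp.prodContinuousLinearEquiv 2 ℂ E F).symm : E × F →L[ℂ] WithLp 2 (E × F)) ∘L S.prod T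

@[simp]
theorem column_apply (S : X →L[ℂ] E) (T : X →L[ℂ] F) (x : X) :
    column S T x = WithLp.toLp 2 (S x, T x) := rfl

/-- The block diagonal operator `S ⊕ T` on the orthogonal direct sum. -/
noncomputable def blockDiagonal (S : E →L[ℂ] E) (T : F →L[ℂ] F) :
    WithLp 2 (E × F) →L[ℂ] WithLp 2 (E × F) :=
  column (S ∘L WithLp.fstL 2 ℂ E F) (T ∘L WithLp.sndL 2 ℂ E F)

@[simp]
theorem blockDiagonal_apply (S : E →L[ℂ] E) (T : F →L[ℂ] F) (x : WithLp 2 (E × F)) :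
    blockDiagonal S T x = WithLp.toLp 2 (S x.fst, T x.snd) := rfl

theorem blockDiagonal_add (S S' : E →L[ℂ] E) (T T' : F →L[ℂ] F) :
    blockDiagonal (S + S') (T + T') = blockDiagonal S T + blockDiagonal S' T' := by
  refine ContinuousLinearMap.ext fun x => WithLp.ofLp_injective 2 (Prod.ext ?_ ?_) <;> simp

theorem blockDiagonal_mul (S S' : E →L[ℂ] E) (T T' : F →L[ℂ] F) :
    blockDiagonal (S * S') (T * T') = blockDiagonal S T * blockDiagonal S' T' := by
  ext x
  simp

theorem blockDiagonal_smul_one (c : ℂ) :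
    blockDiagonal (c • (1 : E →L[ℂ] E)) (c • (1 : F →L[ℂ] F)) = c • 1 := by
  refine ContinuousLinearMap.ext fun x => WithLp.ofLp_injective 2 (Prod.ext ?_ ?_) <;> simp

theorem blockDiagonal_one : blockDiagonal (1 : E →L[ℂ] E) (1 : F →L[ℂ] F) = 1 := by
  refine ContinuousLinearMap.ext fun x => WithLp.ofLp_injective 2 (Prod.ext ?_ ?_) <;> simp

theorem blockDiagonal_injective {S S' : E →L[ℂ] E} {T T' : F →L[ℂ] F}
    (h : blockDiagonal S T = blockDiagonal S' T') : S = S' ∧ T = T' := by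
  constructor
  · ext x
    simpa using congrArg (fun z => z.fst) (DFunLike.congr_fun h (WithLp.toLp 2 (x, 0)))
  · ext x
    simpa using congrArg (fun z => z.snd) (DFunLike.congr_fun h (WithLp.toLp 2 (0, x)))

variable [CompleteSpace E] [CompleteSpace F]

theorem star_blockDiagonal (S : E →L[ℂ] E) (T : F →L[ℂ] F) :
    star (blockDiagonal S T) = blockDiagonal (star S) (star T) := by
  refine ((eq_adjoint_iff _ _).mpr fun x y => ?_).symm
  simp [star_eq_adjoint, adjoint_inner_left]

theorem star_blockDiagonal_mul_mul (C S : E →L[ℂ] E) (D T : F →L[ℂ] F) :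
    star (blockDiagonal C D) * blockDiagonal S T * blockDiagonal C D =
      blockDiagonal (star C * S * C) (star D * T * D) := by
  rw [star_blockDiagonal, blockDiagonal_mul, blockDiagonal_mul]

/-- The operator `(x, y) ↦ (0, V x)`. -/
noncomputable def lowerBlock (V : E →L[ℂ] F) : WithLp 2 (E × F) →L[ℂ] WithLp 2 (E × F) :=
  column 0 (V ∘L WithLp.fstL 2 ℂ E F)

/-- This conjugation moves the compression of the second corner into the first. -/
theorem star_lowerBlock_mul_blockDiagonal_mul (V : E →L[ℂ] F) (S : E →L[ℂ] E) (T : F →L[ℂ] F) :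
    star (lowerBlock V) * blockDiagonal S T * lowerBlock V =
      blockDiagonal (adjoint V ∘L T ∘L V) 0 := by
  have h : column (adjoint V ∘L WithLp.sndL 2 ℂ E F) 0 = star (lowerBlock V) :=
    (eq_adjoint_iff _ _).mpr fun x y => by simp [lowerBlock, adjoint_inner_left]
  rw [← h]
  ext x
  simp [lowerBlock]

variable {A : Type*} [CStarAlgebra A]

/-- The direct sum of two representations. -/
noncomputable def directSumRep (σ : A →⋆ₐ[ℂ] (E →L[ℂ] E)) (τ : A →⋆ₐ[ℂ] (F →L[ℂ] F)) :
    A →⋆ₐ[ℂ] (WithLp 2 (E × F) →L[ℂ] WithLp 2 (E × F)) where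
  toFun a := blockDiagonal (σ a) (τ a)
  map_one' := by rw [map_one, map_one, blockDiagonal_one]
  map_mul' a b := by rw [map_mul, map_mul, blockDiagonal_mul]
  map_zero' := by ext x; simp
  map_add' a b := by rw [map_add, map_add, blockDiagonal_add]
  commutes' c := by
    simp only [Algebra.algebraMap_eq_smul_one, map_smul, map_one, blockDiagonal_smul_one]
  map_star' a := by rw [map_star, map_star, star_blockDiagonal]

theorem directSumRep_apply (σ : A →⋆ₐ[ℂ] (E →L[ℂ] E)) (τ : A →⋆ₐ[ℂ] (F →L[ℂ] F)) (a : A) :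
    directSumRep σ τ a = blockDiagonal (σ a) (τ a) := rfl

/-- The representation of `A` on `E` by scalars given by a character. -/
noncomputable def scalarRep (χ : WeakDual.characterSpace ℂ A) (E : Type*) [NormedAddCommGroup E]
    [InnerProductSpace ℂ E] [CompleteSpace E] : A →⋆ₐ[ℂ] (E →L[ℂ] E) where
  toFun a := χ a • 1
  map_one' := by simp
  map_mul' a b := by simp [smul_smul, mul_comm]
  map_zero' := by simp
  map_add' a b := by simp [add_smul]
  commutes' c := by simp [Algebra.algebraMap_eq_smul_one]
  map_star' a := by simp [map_star]

theorem scalarRep_apply (χ : WeakDual.characterSpace ℂ A) (a : A) :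
    scalarRep χ E a = χ a • 1 := rfl

end DirectSum

/-! ### The unique extension property. -/

section UniqueExtension

open ContinuousLinearMap

instance {E F : Type*} [NormedAddCommGroup E] [NormedAddCommGroup F]
    [TopologicalSpace.SeparableSpace E] [TopologicalSpace.SeparableSpace F] :
    TopologicalSpace.SeparableSpace (WithLp 2 (E × F)) :=
  ((WithLp.homeomorphProd 2 E F).symm.surjective.denseRange).separableSpace
    (WithLp.homeomorphProd 2 E F).symm.continuous

/-- Rigidity is applied to a constant sequence, whose convergence means equality. -/
theorem IsHyperrigid.conj_add_conj_eq {A : Type u} [CStarAlgebra A] {G : Set A}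
    (hG : IsHyperrigid.{t, u} G)
    {L : Type t} [NormedAddCommGroup L] [InnerProductSpace ℂ L] [CompleteSpace L]
    [TopologicalSpace.SeparableSpace L] (ω : A →⋆ₐ[ℂ] (L →L[ℂ] L)) (hω : Function.Injective ω)
    (C D : L →L[ℂ] L) (hCD : star C * 1 * C + star D * 1 * D = 1)
    (hfix : ∀ g ∈ G, star C * ω g * C + star D * ω g * D = ω g) (a : A) :
    star C * ω a * C + star D * ω a * D = ω a := by
  have hconv := hG.rigid L ω hω (fun _ => conjAddCP C D) (fun _ => hCD)
    (fun g hg => by simp [conjAddCP_apply, hfix g hg]) a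
  rw [← sub_eq_zero, ← norm_eq_zero]
  exact tendsto_nhds_unique tendsto_const_nhds hconv

/-- The unique extension property of hyperrigid sets, for maps given by a dilation. -/
theorem IsHyperrigid.eq_compression {A : Type u} [CStarAlgebra A] {G : Set A}
    (hG : IsHyperrigid.{max u v w, u} G)
    {H : Type v} [NormedAddCommGroup H] [InnerProductSpace ℂ H] [CompleteSpace H]
    [TopologicalSpace.SeparableSpace H]
    {N : Type (max v w)} [NormedAddCommGroup N] [InnerProductSpace ℂ N] [CompleteSpace N]
    [TopologicalSpace.SeparableSpace N]
    (π : A →⋆ₐ[ℂ] (H →L[ℂ] H)) (τ : A →⋆ₐ[ℂ] (N →L[ℂ] N))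
    (V : H →L[ℂ] N) (hV : adjoint V ∘L V = 1)
    (hπ : ∀ g ∈ G, π g = adjoint V ∘L τ g ∘L V) (a : A) :
    π a = adjoint V ∘L τ a ∘L V := by
  have := separableSpace_of_generates hG.countable hG.generates
  -- Neither `π` nor `τ` need be faithful, so `σ` is added as a summand to meet the faithfulness
  -- requirement.
  obtain ⟨E, _, _, _, _, σ, hσ⟩ := exists_faithful_representation A
  -- The operator `0 ⊕ lowerBlock V` fills the `H` corner with `V* T' V`, while the projection `1 ⊕
  -- 0 ⊕ 1` keeps the other two corners.
  have hconj : ∀ (S : E →L[ℂ] E) (T : H →L[ℂ] H) (T' : N →L[ℂ] N),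
      star (blockDiagonal (0 : E →L[ℂ] E) (lowerBlock V)) *
          blockDiagonal S (blockDiagonal T T') * blockDiagonal 0 (lowerBlock V) +
        star (blockDiagonal (1 : E →L[ℂ] E) (blockDiagonal (0 : H →L[ℂ] H) (1 : N →L[ℂ] N))) *
          blockDiagonal S (blockDiagonal T T') * blockDiagonal 1 (blockDiagonal 0 1) =
        blockDiagonal S (blockDiagonal (adjoint V ∘L T' ∘L V) T') := fun S T T' => by
    rw [star_blockDiagonal_mul_mul, star_blockDiagonal_mul_mul, star_blockDiagonal_mul_mul,
      star_lowerBlock_mul_blockDiagonal_mul, ← blockDiagonal_add, ← blockDiagonal_add]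
    simp only [mul_zero, zero_add, star_one, one_mul, mul_one, add_zero]
  have hfix := hG.conj_add_conj_eq (directSumRep σ (directSumRep π τ))
    (fun a b h => hσ (blockDiagonal_injective h).1)
    (blockDiagonal 0 (lowerBlock V)) (blockDiagonal 1 (blockDiagonal 0 1))
    (by
      have := hconj 1 1 1
      rwa [show adjoint V ∘L 1 ∘L V = 1 from hV, blockDiagonal_one, blockDiagonal_one] at this)
    (fun g hg => by
      rw [directSumRep_apply, directSumRep_apply, hconj, ← hπ g hg]) a
  rw [directSumRep_apply, directSumRep_apply, hconj] at hfix
  exact (blockDiagonal_injective (blockDiagonal_injective hfix).2).1.symm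

/-- A multiplicative compression by an isometry is a restriction to a reducing subspace. -/
theorem intertwines_of_eq_compression {A : Type*} [CStarAlgebra A]
    {H N : Type*} [NormedAddCommGroup H] [InnerProductSpace ℂ H] [CompleteSpace H]
    [NormedAddCommGroup N] [InnerProductSpace ℂ N] [CompleteSpace N]
    (π : A →⋆ₐ[ℂ] (H →L[ℂ] H)) (τ : A →⋆ₐ[ℂ] (N →L[ℂ] N))
    (V : H →L[ℂ] N) (hV : adjoint V ∘L V = 1)
    (hπ : ∀ a, π a = adjoint V ∘L τ a ∘L V) (a : A) : τ a ∘L V = V ∘L π a := by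
  have hmul : adjoint (π a) ∘L π a = adjoint V ∘L (adjoint (τ a) ∘L τ a) ∘L V := by
    have := hπ (star a * a)
    rw [map_mul, map_mul, map_star, map_star] at this
    exact this
  have hV' : ∀ x, adjoint V (V x) = x := fun x => DFunLike.congr_fun hV x
  have hπ' : ∀ x, adjoint V (τ a (V x)) = π a x := fun x => (DFunLike.congr_fun (hπ a) x).symm
  ext x
  rw [coe_comp, coe_comp, Function.comp_apply, Function.comp_apply, ← sub_eq_zero,
    ← inner_self_eq_zero (𝕜 := ℂ)]
  -- All four terms in the expansion of `‖τ(a) V x - V π(a) x‖²` equal `‖π(a) x‖²` up to sign; this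
  -- one uses multiplicativity at `star a * a`.
  have h1 : ⟪τ a (V x), τ a (V x)⟫_ℂ = ⟪π a x, π a x⟫_ℂ := by
    rw [← adjoint_inner_left, ← adjoint_inner_left V, ← adjoint_inner_left (π a)]
    exact congrArg (⟪·, x⟫_ℂ) (DFunLike.congr_fun hmul x).symm
  rw [inner_sub_left, inner_sub_right, inner_sub_right, h1, ← adjoint_inner_right V, hπ',
    ← adjoint_inner_left V, hπ', ← adjoint_inner_left V, hV']
  simp

end UniqueExtension

/-! ### Dilation of the contraction to an isometry. -/

section Intertwining

open ContinuousLinearMap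

variable {A : Type u} [CStarAlgebra A]
variable {H : Type v} [NormedAddCommGroup H] [InnerProductSpace ℂ H] [CompleteSpace H]
variable {K : Type w} [NormedAddCommGroup K] [InnerProductSpace ℂ K] [CompleteSpace K]

theorem defect_nonneg {R : H →L[ℂ] K} (hR : ‖R‖ ≤ 1) : 0 ≤ defect R := by
  have hpos : 0 ≤ adjoint R ∘L R := (nonneg_iff_isPositive _).mpr R.isPositive_adjoint_comp_self
  refine sub_nonneg.mpr ((CStarAlgebra.norm_le_one_iff_of_nonneg _ hpos).mp ?_)
  rw [norm_adjoint_comp_self]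
  exact mul_le_one₀ hR (norm_nonneg _) hR

theorem adjoint_column_comp_column {L : Type*} [NormedAddCommGroup L] [InnerProductSpace ℂ L]
    [CompleteSpace L] (R S : H →L[ℂ] K) (D D' : H →L[ℂ] L) :
    adjoint (column R D) ∘L column S D' = adjoint R ∘L S + adjoint D ∘L D' := by
  ext x
  refine ext_inner_right ℂ fun y => ?_
  simp [adjoint_inner_left, inner_add_left]

theorem comp_adjoint_eq_one_of_surjective {T : H →L[ℂ] K} (hT : adjoint T ∘L T = 1)
    (hsurj : Function.Surjective T) : T ∘L adjoint T = 1 := by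
  ext y
  obtain ⟨x, rfl⟩ := hsurj y
  exact congrArg T (DFunLike.congr_fun hT x)

theorem mem_jointEigenspace {χ : WeakDual.characterSpace ℂ A} {π : A →⋆ₐ[ℂ] (H →L[ℂ] H)} {x : H} :
    x ∈ jointEigenspace χ π ↔ ∀ a, π a x = χ a • x := by
  simp [jointEigenspace, sub_eq_zero]

theorem intertwines_and_range_defect_le {G : Set A} (hG : IsHyperrigid.{max u v w, u} G)
    (χ : WeakDual.characterSpace ℂ A) (hχ : ∀ g ∈ G, χ g = 0)
    [TopologicalSpace.SeparableSpace H] [TopologicalSpace.SeparableSpace K]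
    (π : A →⋆ₐ[ℂ] (H →L[ℂ] H)) (ρ : A →⋆ₐ[ℂ] (K →L[ℂ] K)) (R : H →L[ℂ] K) (hR : ‖R‖ ≤ 1)
    (hπ : ∀ g ∈ G, π g = adjoint R ∘L ρ g ∘L R) :
    (∀ a x, ρ a (R x) = R (π a x)) ∧ ∀ x, defect R x ∈ jointEigenspace χ π := by
  -- Any `D` with `D*D` equal to the defect makes the column `(R, D)` isometric.
  obtain ⟨D, hD⟩ := CStarAlgebra.nonneg_iff_eq_star_mul_self.mp (defect_nonneg hR)
  have hcomp : ∀ a, directSumRep ρ (scalarRep χ H) a ∘L column R D =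
      column (ρ a ∘L R) (χ a • D) := fun a => by
    ext x
    simp [directSumRep_apply, scalarRep_apply]
  have hcompr : ∀ T : H →L[ℂ] H, column R D ∘L T = column (R ∘L T) (D ∘L T) := fun T => rfl
  have hV : adjoint (column R D) ∘L column R D = 1 := by
    rw [adjoint_column_comp_column]
    change adjoint R ∘L R + star D * D = 1
    rw [← hD, defect, add_sub_cancel]
  have hτ : ∀ a, directSumRep ρ (scalarRep χ H) a ∘L column R D = column R D ∘L π a := by
    refine intertwines_of_eq_compression π _ _ hV ?_
    refine IsHyperrigid.eq_compression.{u, v, w} hG π _ _ hV fun g hg => ?_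
    rw [hcomp, adjoint_column_comp_column, hχ g hg, zero_smul, comp_zero, add_zero, hπ g hg]
  have hpair : ∀ a x, ρ a (R x) = R (π a x) ∧ χ a • D x = D (π a x) := fun a x => by
    have := DFunLike.congr_fun ((hcomp a).symm.trans ((hτ a).trans (hcompr (π a)))) x
    exact ⟨congrArg (fun z => z.fst) this, congrArg (fun z => z.snd) this⟩
  refine ⟨fun a x => (hpair a x).1, fun x => mem_jointEigenspace.mpr fun a => ?_⟩
  have hDD : ∀ x, defect R x = adjoint D (D x) := fun x => DFunLike.congr_fun hD x
  refine ext_inner_right ℂ fun y => ?_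
  -- This is the adjoint relation `π(a) D* = χ(a) D*`, obtained from `χ(a*) D = D π(a*)` and applied
  -- to `D x`.
  rw [hDD, inner_smul_left, ← adjoint_inner_right (π a), adjoint_inner_left, adjoint_inner_left,
    ← star_eq_adjoint, ← map_star, ← (hpair (star a) y).2, inner_smul_right, map_star]
  rfl

end Intertwining

theorem map_le_closedSpan {A : Type u} [CStarAlgebra A]
    {H : Type v} [NormedAddCommGroup H] [InnerProductSpace ℂ H]
    {K : Type w} [NormedAddCommGroup K] [InnerProductSpace ℂ K] [CompleteSpace K]
    (ρ : A →⋆ₐ[ℂ] (K →L[ℂ] K)) (R : H →L[ℂ] K) (M : Submodule ℂ H) :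
    M.map (R : H →ₗ[ℂ] K) ≤ closedSpan ρ R M := by
  refine le_trans ?_ (Submodule.le_topologicalClosure _)
  refine le_trans ?_ (le_iSup _ (1 : A))
  rintro _ ⟨x, hx, rfl⟩
  exact ⟨x, hx, by simp⟩

/-! ### Reducing subspaces and the geometry of `R`. -/

section Geometry

open ContinuousLinearMap

variable {A : Type u} [CStarAlgebra A]
variable {H : Type v} [NormedAddCommGroup H] [InnerProductSpace ℂ H] [CompleteSpace H]
variable {K : Type w} [NormedAddCommGroup K] [InnerProductSpace ℂ K] [CompleteSpace K]

theorem reducesRep_of_invariant {M : Submodule ℂ H} {π : A →⋆ₐ[ℂ] (H →L[ℂ] H)}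
    (h : ∀ a, ∀ x ∈ M, π a x ∈ M) : ReducesRep M π := fun a =>
  ⟨h a, by rw [← star_eq_adjoint, ← map_star]; exact h (star a)⟩

theorem ReducesRep.orthogonal {M : Submodule ℂ H} {π : A →⋆ₐ[ℂ] (H →L[ℂ] H)}
    (h : ReducesRep M π) : ReducesRep Mᗮ π :=
  reducesRep_of_invariant fun a x hx => (Submodule.mem_orthogonal _ _).mpr fun y hy => by
    rw [← adjoint_inner_left]
    exact hx _ ((h a).2 y hy)

theorem reducesRep_jointEigenspace (χ : WeakDual.characterSpace ℂ A)
    (π : A →⋆ₐ[ℂ] (H →L[ℂ] H)) : ReducesRep (jointEigenspace χ π) π :=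
  reducesRep_of_invariant fun a x hx => by
    rw [mem_jointEigenspace.mp hx a]
    exact Submodule.smul_mem _ _ hx

theorem defect_apply (R : H →L[ℂ] K) (x : H) : defect R x = x - adjoint R (R x) := rfl

theorem adjoint_defect (R : H →L[ℂ] K) : adjoint (defect R) = defect R := by
  rw [defect, map_sub, adjoint_comp, adjoint_adjoint, ← star_eq_adjoint, star_one]

theorem reduces_of_isSelfAdjoint {M : Submodule ℂ H} {T : H →L[ℂ] H} (hT : adjoint T = T)
    (h : ∀ x ∈ M, T x ∈ M) : Reduces M T := ⟨h, by rwa [hT]⟩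

variable {π : A →⋆ₐ[ℂ] (H →L[ℂ] H)} {ρ : A →⋆ₐ[ℂ] (K →L[ℂ] K)} {R : H →L[ℂ] K}

/-- Intertwining gives `ρ(a) R M = R π(a) M ⊆ R M`, so the span adds nothing to the closure of `R
M`. -/
theorem closedSpan_eq_of_intertwines (hint : ∀ a x, ρ a (R x) = R (π a x)) {M : Submodule ℂ H}
    (hM : ReducesRep M π) :
    closedSpan ρ R M = (M.map (R : H →ₗ[ℂ] K)).topologicalClosure := by
  refine le_antisymm (Submodule.topologicalClosure_mono (iSup_le fun a => ?_))
    (Submodule.topologicalClosure_minimal _ (map_le_closedSpan ρ R M)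
      (Submodule.isClosed_topologicalClosure _))
  rintro _ ⟨x, hx, rfl⟩
  exact ⟨π a x, (hM a).1 x hx, (hint a x).symm⟩

theorem reducesRep_closedSpan (hint : ∀ a x, ρ a (R x) = R (π a x)) {M : Submodule ℂ H}
    (hM : ReducesRep M π) : ReducesRep (closedSpan ρ R M) ρ := by
  rw [closedSpan_eq_of_intertwines hint hM]
  refine reducesRep_of_invariant fun a y hy => map_mem_closure (ρ a).continuous hy ?_
  rintro _ ⟨x, hx, rfl⟩
  exact ⟨π a x, (hM a).1 x hx, (hint a x).symm⟩

/-- The difference of the two sides is an inner product of `defect R x` with `y`. Taking `x` in `M`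
gives orthogonality of the images; taking `x = y` gives isometry on `Mᗮ`. -/
theorem inner_map_of_mem_of_mem_orthogonal {M : Submodule ℂ H} (hM : ∀ x, defect R x ∈ M)
    (x : H) {y : H} (hy : y ∈ Mᗮ) : ⟪R x, R y⟫_ℂ = ⟪x, y⟫_ℂ := by
  have h := hy _ (hM x)
  rw [defect_apply, inner_sub_left, adjoint_inner_left, sub_eq_zero] at h
  exact h.symm

theorem closedSpan_isOrtho_closedSpan_orthogonal (hint : ∀ a x, ρ a (R x) = R (π a x))
    {M : Submodule ℂ H} (hM : ReducesRep M π) (hdef : ∀ x, defect R x ∈ M) :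
    closedSpan ρ R M ⟂ closedSpan ρ R Mᗮ := by
  rw [closedSpan_eq_of_intertwines hint hM, closedSpan_eq_of_intertwines hint hM.orthogonal,
    Submodule.isOrtho_iff_le, Submodule.orthogonal_closure]
  refine Submodule.topologicalClosure_minimal _ ?_ (Submodule.isClosed_orthogonal _)
  rintro _ ⟨x, hx, rfl⟩
  refine (Submodule.mem_orthogonal' _ _).mpr ?_
  rintro _ ⟨y, hy, rfl⟩
  exact (inner_map_of_mem_of_mem_orthogonal hdef x hy).trans (hy x hx)

theorem isometry_restrict_orthogonal {M : Submodule ℂ H} (hdef : ∀ x, defect R x ∈ M) :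
    Isometry fun x : Mᗮ => R x :=
  AddMonoidHomClass.isometry_of_norm (R ∘L Mᗮ.subtypeL) fun x => by
    have h := inner_map_of_mem_of_mem_orthogonal hdef (x : H) x.2
    rw [inner_self_eq_norm_sq_to_K, inner_self_eq_norm_sq_to_K] at h
    exact (sq_eq_sq₀ (norm_nonneg _) (norm_nonneg _)).mp (by exact_mod_cast h)

/-- An isometry on the complete space `Mᗮ` has closed range. This later yields surjectivity of `R₀`.
-/
theorem closedSpan_orthogonal_eq_map (hint : ∀ a x, ρ a (R x) = R (π a x))
    {M : Submodule ℂ H} (hM : ReducesRep M π) (hdef : ∀ x, defect R x ∈ M) :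
    closedSpan ρ R Mᗮ = Mᗮ.map (R : H →ₗ[ℂ] K) := by
  rw [closedSpan_eq_of_intertwines hint hM.orthogonal]
  refine IsClosed.submodule_topologicalClosure_eq ?_
  have h := (isometry_restrict_orthogonal hdef).isClosedEmbedding.isClosed_range
  rwa [Set.range_comp' R, Subtype.range_coe] at h

/-- Under minimality the two orthogonal closed spans have dense sum, so nothing is orthogonal to
both. -/
theorem closedSpan_orthogonal_eq_orthogonal (hint : ∀ a x, ρ a (R x) = R (π a x))
    {M : Submodule ℂ H} [CompleteSpace M] (hM : ReducesRep M π) (hdef : ∀ x, defect R x ∈ M)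
    (hmin : closedSpan ρ R ⊤ = ⊤) : closedSpan ρ R Mᗮ = (closedSpan ρ R M)ᗮ := by
  have hle : closedSpan ρ R ⊤ ≤ ((closedSpan ρ R M) ⊔ (closedSpan ρ R Mᗮ)).topologicalClosure := by
    refine Submodule.topologicalClosure_mono (iSup_le fun a => ?_)
    rw [← Submodule.sup_orthogonal_of_hasOrthogonalProjection (K := M), Submodule.map_sup]
    exact sup_le_sup
      ((le_iSup (fun a : A => M.map ((ρ a ∘L R : H →L[ℂ] K) : H →ₗ[ℂ] K)) a).trans
        (Submodule.le_topologicalClosure _))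
      ((le_iSup (fun a : A => Mᗮ.map ((ρ a ∘L R : H →L[ℂ] K) : H →ₗ[ℂ] K)) a).trans
        (Submodule.le_topologicalClosure _))
  have hbot : (closedSpan ρ R M)ᗮ ⊓ (closedSpan ρ R Mᗮ)ᗮ = ⊥ := by
    rw [Submodule.inf_orthogonal, ← Submodule.orthogonal_closure, top_le_iff.mp (hmin.ge.trans hle),
      Submodule.top_orthogonal_eq_bot]
  have hortho := (closedSpan_isOrtho_closedSpan_orthogonal hint hM hdef).symm
  have := Submodule.sup_orthogonal_inf_of_hasOrthogonalProjection hortho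
  rwa [inf_comm, hbot, sup_bot_eq] at this

end Geometry

end ChiDecomp

/-! ### The decomposition theorem. -/

open ChiDecomp in
theorem theorem2p8 {A : Type u} [CStarAlgebra A] (G : Set A)
    (hG : IsHyperrigid.{max u v w, u} G)
    (χ : WeakDual.characterSpace ℂ A) (hχ : ∀ g ∈ G, χ g = 0)
    {H : Type v} [NormedAddCommGroup H] [InnerProductSpace ℂ H] [CompleteSpace H]
    [TopologicalSpace.SeparableSpace H]
    {K : Type w} [NormedAddCommGroup K] [InnerProductSpace ℂ K] [CompleteSpace K]
    [TopologicalSpace.SeparableSpace K]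
    (π : A →⋆ₐ[ℂ] (H →L[ℂ] H)) (ρ : A →⋆ₐ[ℂ] (K →L[ℂ] K))
    (R : H →L[ℂ] K) (hR : ‖R‖ ≤ 1)
    (hπ : ∀ g ∈ G, π g = ContinuousLinearMap.adjoint R ∘L ρ g ∘L R) :
    (ReducesRep (jointEigenspace χ π) π ∧
      Reduces (jointEigenspace χ π) (ContinuousLinearMap.adjoint R ∘L R) ∧
      Reduces (jointEigenspace χ π) (defect R)) ∧
    (ReducesRep (closedSpan ρ R (jointEigenspace χ π)) ρ ∧
      ReducesRep (closedSpan ρ R (jointEigenspace χ π)ᗮ) ρ) ∧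
    (closedSpan ρ R (jointEigenspace χ π) =
        ((jointEigenspace χ π).map (R : H →ₗ[ℂ] K)).topologicalClosure ∧
      closedSpan ρ R (jointEigenspace χ π)ᗮ =
        ((jointEigenspace χ π)ᗮ.map (R : H →ₗ[ℂ] K)).topologicalClosure ∧
      closedSpan ρ R (jointEigenspace χ π) ⟂ closedSpan ρ R (jointEigenspace χ π)ᗮ) ∧
    ((jointEigenspace χ π).map (R : H →ₗ[ℂ] K) ≤ jointEigenspace χ ρ ∧
      LinearMap.range (defect R : H →ₗ[ℂ] H) ≤ jointEigenspace χ π) ∧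
    -- the last part concerns a minimal `K`; the block `R₀` is determined by `R`
    ∃ (R₀ : ((jointEigenspace χ π)ᗮ : Submodule ℂ H) →L[ℂ]
          ((closedSpan ρ R (jointEigenspace χ π))ᗮ : Submodule ℂ K))
      (R₁ : jointEigenspace χ π →L[ℂ] closedSpan ρ R (jointEigenspace χ π))
      (h : IsIsometricChiDecomposition χ π ρ R
        (jointEigenspace χ π)ᗮ (jointEigenspace χ π)
        (closedSpan ρ R (jointEigenspace χ π))ᗮ (closedSpan ρ R (jointEigenspace χ π)) R₀ R₁),
      (∀ a, R₀ ∘L restrictRep π h.reducesH₀ a = restrictRep ρ h.reducesK₀ a ∘L R₀) ∧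
      (closedSpan ρ R ⊤ = ⊤ →
        closedSpan ρ R (jointEigenspace χ π)ᗮ = (closedSpan ρ R (jointEigenspace χ π))ᗮ ∧
        IsUnitaryChiDecomposition χ π ρ R
          (jointEigenspace χ π)ᗮ (jointEigenspace χ π)
          (closedSpan ρ R (jointEigenspace χ π))ᗮ
          (closedSpan ρ R (jointEigenspace χ π)) R₀ R₁) := by 
  obtain ⟨hint, hdef⟩ := intertwines_and_range_defect_le hG χ hχ π ρ R hR hπ
  have hM := reducesRep_jointEigenspace χ π
  have hL := reducesRep_closedSpan hint hM
  have hortho := closedSpan_isOrtho_closedSpan_orthogonal hint hM hdef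
  have hRM : ∀ x ∈ jointEigenspace χ π, R x ∈ jointEigenspace χ ρ := fun x hx =>
    mem_jointEigenspace.mpr fun a => by rw [hint, mem_jointEigenspace.mp hx, map_smul]
  have hLρ : closedSpan ρ R (jointEigenspace χ π) ≤ jointEigenspace χ ρ := by
    rw [closedSpan_eq_of_intertwines hint hM]
    exact Submodule.topologicalClosure_minimal _ (Submodule.map_le_iff_le_comap.mpr hRM)
      (isClosed_jointEigenspace χ ρ)
  have h₀ : ∀ x ∈ (jointEigenspace χ π)ᗮ, R x ∈ (closedSpan ρ R (jointEigenspace χ π))ᗮ :=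
    fun x hx => hortho.symm (map_le_closedSpan ρ R _ ⟨x, hx, rfl⟩)
  have h₁ : ∀ x ∈ jointEigenspace χ π, R x ∈ closedSpan ρ R (jointEigenspace χ π) :=
    fun x hx => map_le_closedSpan ρ R _ ⟨x, hx, rfl⟩
  let R₀ := R.restrict h₀
  let R₁ := R.restrict h₁
  have hinner : ∀ x y, ⟪R₀ x, R₀ y⟫_ℂ = ⟪x, y⟫_ℂ := fun x y =>
    inner_map_of_mem_of_mem_orthogonal hdef x y.2
  have hadj : ContinuousLinearMap.adjoint R₀ ∘L R₀ = 1 := by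
    ext1 x
    refine ext_inner_right ℂ fun y => ?_
    rw [ContinuousLinearMap.comp_apply, ContinuousLinearMap.adjoint_inner_left, hinner]
    rfl
  have hcomm : ∀ a, R₀ ∘L restrictRep π hM.orthogonal a = restrictRep ρ hL.orthogonal a ∘L R₀ :=
    fun a => ContinuousLinearMap.ext fun x => Subtype.ext (hint a x).symm
  have hdec : IsChiDecomposition χ π ρ R
      (jointEigenspace χ π)ᗮ (jointEigenspace χ π)
      (closedSpan ρ R (jointEigenspace χ π))ᗮ (closedSpan ρ R (jointEigenspace χ π)) R₀ R₁ :=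
    { orthoH := (Submodule.isOrtho_orthogonal_right _).symm
      sumH := by rw [sup_comm, Submodule.sup_orthogonal_of_hasOrthogonalProjection]
      orthoK := (Submodule.isOrtho_orthogonal_right _).symm
      sumK := by rw [sup_comm, Submodule.sup_orthogonal_of_hasOrthogonalProjection]
      reducesH₀ := hM.orthogonal
      reducesH₁ := hM
      reducesK₀ := hL.orthogonal
      reducesK₁ := hL
      scalarH₁ := fun a => ContinuousLinearMap.ext fun x =>
        Subtype.ext (mem_jointEigenspace.mp x.2 a)
      scalarK₁ := fun a => ContinuousLinearMap.ext fun x =>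
        Subtype.ext (mem_jointEigenspace.mp (hLρ x.2) a)
      block₀ := fun _ => rfl
      block₁ := fun _ => rfl
      -- Intertwining moves `R₀` to the left, where `R₀* R₀ = 1` cancels it.
      compress := fun a => by
        rw [← hcomm, ← ContinuousLinearMap.comp_assoc, hadj]
        rfl }
  refine ⟨⟨hM, ?_, ?_⟩, ⟨hL, reducesRep_closedSpan hint hM.orthogonal⟩,
    ⟨closedSpan_eq_of_intertwines hint hM, closedSpan_eq_of_intertwines hint hM.orthogonal,
      hortho⟩, ⟨?_, ?_⟩, R₀, R₁, ⟨hdec, ?_⟩, hcomm, fun hmin => ?_⟩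
  · refine reduces_of_isSelfAdjoint ?_ fun x hx => ?_
    · rw [ContinuousLinearMap.adjoint_comp, ContinuousLinearMap.adjoint_adjoint]
    -- Here `R*R x` is `x` minus its defect, and both lie in the eigenspace.
    · have := Submodule.sub_mem _ hx (hdef x)
      rwa [defect_apply, sub_sub_cancel] at this
  · exact reduces_of_isSelfAdjoint (adjoint_defect R) fun x _ => hdef x
  · exact Submodule.map_le_iff_le_comap.mpr hRM
  · rintro _ ⟨x, rfl⟩
    exact hdef x
  · exact isometry_restrict_orthogonal hdef
  · have heq := closedSpan_orthogonal_eq_orthogonal hint hM hdef hmin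
    refine ⟨heq, hdec, hadj, comp_adjoint_eq_one_of_surjective hadj fun y => ?_⟩
    obtain ⟨x, hx, hxy⟩ := (closedSpan_orthogonal_eq_map hint hM hdef).le (heq.ge y.2)
    exact ⟨⟨x, hx⟩, Subtype.ext hxy⟩
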